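/- Let $\Sigma$ be a real-analytic surface. Consider the polarized $U(1)$-symmetric vacuum Einstein equations reduced to $\Sigma\times\mathbb R$ with 2+1 metric ${}^3g=-N^2dt^2+\gamma$ (zero shift), $N=e^{\lambda}$, $\gamma_{ab}=e^{\lambda}\sigma_{ab}$, extrinsic curvature $k_{ab}$, $\tau=\gamma^{ab}k_{ab}$, scalar field $\phi$ and momentum $p$. Put $\psi=\sigma^{ab}\partial_t\sigma_{ab}$. The evolution equations are $$\partial_t\gamma_{ab}=-2Nk_{ab},\qquad \partial_tk_{ab}=NR_{ab}-2Nk_{ac}k^c_b+N\tau k_{ab}-\nabla_a\partial_bN-2N\partial_a\phi\,\partial_b\phi,$$ $$\partial_t\phi=Np,\qquad \partial_tp=-\tfrac12p\psi-p\,\partial_t\lambda+e^{\lambda}\gamma^{ab}(\nabla_a\nabla_b\phi+\nabla_b\phi\,\partial_a\lambda),$$ and the constraint functions are $$C_0=-\tfrac12\big[R(\gamma)-k_a^bk_b^a+\tau^2-2p^2-2|\nabla\phi|_\gamma^2\big],\qquad C_a=-\big[\nabla_bk_a^b-\partial_a\tau+2p\,\partial_a\phi\big].$$ Let $\mathcal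 A=(\tilde\sigma,\tilde\phi,\tilde\lambda,\tilde v,\tilde w)$ be asymptotic data: an analytic Riemannian metric and four analytic functions on $\Sigma$. Let $\epsilon_\sigma,\epsilon_k,\epsilon_{\sigma'},\epsilon_\phi,\epsilon_p,\epsilon_{\phi'}>0$ satisfy $\tilde v(x)>\epsilon_k>\max\{\epsilon_\sigma,\epsilon_{\sigma'},\epsilon_p\}$ for all $x\in\Sigma$ and $\epsilon_p>\max\{\epsilon_\phi,\epsilon_{\phi'}\}$. Write $\hat\lambda=\tilde\lambda-\tilde vt$ and $\hat\phi=\tilde\phi-\tilde wt$. An AVTD solution $\mathcal S_{\mathcal A}(t)=(\gamma,k,\phi,p)$ with asymptotic data $\mathcal A$ is a spatially analytic solution of the evolution equations for all sufficiently large $t$, in the gauge $\lambda=\hat\lambda$, of the form $$\sigma^{ab}=\tilde\sigma^{ab}+e^{-\epsilon_\sigma t}\delta\sigma^{ab},\quad k_a^b=e^{-\lambda}\big(\tfrac12\tilde v\,\delta_a^b+e^{-\epsilon_kt}\delta k_a^b\big),\quad \phi=\hat\phi+e^{-\epsilon_\phi t}\delta\phi,\quad p=e^{-\lambda}\big(-\tilde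 w+e^{-\epsilon_pt}\delta p\big),$$ $$\tilde\nabla_c\sigma^{ab}=e^{-\epsilon_{\sigma'}t}\delta\sigma^{ab}_{[c]},\qquad \partial_c\phi=\partial_c\hat\phi+e^{-\epsilon_{\phi'}t}\delta\phi_{[c]},$$ where $\tilde\nabla$ is the Levi-Civita connection of $\tilde\sigma$ and, in coordinates, all the remainders $\delta\sigma^{ab},\delta k_a^b,\delta\phi,\delta p,\delta\sigma^{ab}_{[c]},\delta\phi_{[c]}$ tend to $0$ as $t\to\infty$, locally uniformly together with their first spatial derivatives. Let $$\hat C_0(\mathcal A)=-\tfrac12e^{-2\hat\lambda}\big(\tfrac12\tilde v^2-2\tilde w^2\big),\qquad \hat C_a(\mathcal A)=\tfrac12e^{-\hat\lambda}\big[-\tilde v(\partial_a\tilde\lambda-t\,\partial_a\tilde v)+\partial_a\tilde v+4\tilde w\,(\partial_a\tilde\phi-t\,\partial_a\tilde w)\big]$$ be the VTD constraints. Lemma 1. For every choice of $\mathcal A$ (and of exponents as above) and every AVTD solution $\mathcal S_{\mathcal A}(t)$ with asymptotic data $\mathcal A$, the constraint functions converge to the VTD constraints as $t\to\infty$, in the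 natural weights $e^{2\lambda}$ and $e^{\lambda}$: $$e^{2\lambda}\big(C_0(\mathcal S_{\mathcal A}(t))-\hat C_0(\mathcal A)\big)\to0,\qquad e^{\lambda}\big(C_a(\mathcal S_{\mathcal A}(t))-\hat C_a(\mathcal A)\big)\to0\quad(a=1,2),$$ locally uniformly in every coordinate chart of the atlas of $\Sigma$. In particular $e^{2\lambda}C_0(\mathcal S_{\mathcal A}(t))\to-\tfrac12\big(\tfrac12\tilde v^2-2\tilde w^2\big)$. -/

import Mathlib

open Filter Topology
open scoped Manifold ContDiff

noncomputable section

namespace AVTD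

/-- The model space of a surface: the plane, with coordinates `y 0`, `y 1`. -/
abbrev Plane : Type := EuclideanSpace ℝ (Fin 2)

/-- Real `2 × 2` matrices, used for the components of 2-tensors at a point. -/
abbrev Mat : Type := Matrix (Fin 2) (Fin 2) ℝ

/-! ### Tensor calculus in a coordinate domain -/

/-- The coordinate partial derivative `∂_a f` at `y`. -/
def pd (a : Fin 2) (f : Plane → ℝ) (y : Plane) : ℝ :=
  fderiv ℝ f y (EuclideanSpace.single a 1)

/-- Christoffel symbols `Γ^c_{ab}` of the metric with components `g`. -/
def christoffel (g : Plane → Mat) (c a b : Fin 2) (y : Plane) : ℝ :=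
  (1 / 2) * ∑ d, (g y)⁻¹ c d *
    (pd a (fun z => g z d b) y + pd b (fun z => g z d a) y - pd d (fun z => g z a b) y)

/-- Ricci curvature `R_{ab}` of the metric with components `g`
(positive on round spheres). -/
def ricci (g : Plane → Mat) (a b : Fin 2) (y : Plane) : ℝ :=
  (∑ c, pd c (christoffel g c a b) y) - (∑ c, pd b (christoffel g c a c) y)
    + ∑ c, ∑ d, (christoffel g c c d y * christoffel g d a b y
        - christoffel g c b d y * christoffel g d a c y)

/-- Scalar curvature `R = g^{ab} R_{ab}`. -/
def scalarCurv (g : Plane → Mat) (y : Plane) : ℝ :=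
  ∑ a, ∑ b, (g y)⁻¹ a b * ricci g a b y

/-- Second covariant derivative `∇_a ∇_b f` of a function. -/
def hessian (g : Plane → Mat) (f : Plane → ℝ) (a b : Fin 2) (y : Plane) : ℝ :=
  pd a (pd b f) y - ∑ c, christoffel g c a b y * pd c f y

/-- The mixed components `k_a^b = γ^{bc} k_{ac}`, with `a` the first index. -/
def mixed (g k : Plane → Mat) (a b : Fin 2) (y : Plane) : ℝ :=
  ∑ c, (g y)⁻¹ b c * k y a c

/-- The trace `γ^{ab} k_{ab}`. -/
def trace (g k : Plane → Mat) (y : Plane) : ℝ :=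
  ∑ a, ∑ b, (g y)⁻¹ a b * k y a b

/-- The divergence `∇_b k_a^b`. -/
def divergence (g k : Plane → Mat) (a : Fin 2) (y : Plane) : ℝ :=
  (∑ b, pd b (mixed g k a b) y)
    + ∑ b, ∑ c, (christoffel g b b c y * mixed g k a c y
        - christoffel g c b a y * mixed g k c b y)

/-- The covariant derivative `∇_c s^{ab}`, with respect to the Levi-Civita connection of `g`, of
the contravariant 2-tensor with components `s`. -/
def covDerivUpper (g s : Plane → Mat) (c a b : Fin 2) (y : Plane) : ℝ :=
  pd c (fun z => s z a b) y
    + ∑ d, (christoffel g a c d y * s y d b + christoffel g b c d y * s y a d)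

/-- The Hamiltonian constraint function
`C_0 = -½ [R(γ) - k_a^b k_b^a + τ² - 2 p² - 2 γ^{ab} ∂_a φ ∂_b φ]`. -/
def hamiltonianC (g k : Plane → Mat) (φ p : Plane → ℝ) (y : Plane) : ℝ :=
  -(1 / 2) * (scalarCurv g y - (∑ a, ∑ b, mixed g k a b y * mixed g k b a y)
    + trace g k y ^ 2 - 2 * p y ^ 2 - 2 * ∑ a, ∑ b, (g y)⁻¹ a b * pd a φ y * pd b φ y)

/-- The momentum constraint functions `C_a = -[∇_b k_a^b - ∂_a τ + 2 p ∂_a φ]`. -/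
def momentumC (g k : Plane → Mat) (φ p : Plane → ℝ) (a : Fin 2) (y : Plane) : ℝ :=
  -(divergence g k a y - pd a (trace g k) y + 2 * p y * pd a φ y)

/-! ### Fields on a surface and their components in a chart -/

section Surface

variable {M : Type*} [TopologicalSpace M] [ChartedSpace Plane M]

/-- The coordinate vector field `∂_a` of the chart `e`, at the point with coordinates `y`. -/
def coordVec (e : OpenPartialHomeomorph M Plane) (a : Fin 2) (y : Plane) :
    TangentSpace 𝓘(ℝ, Plane) (e.symm y) :=
  mfderiv 𝓘(ℝ, Plane) 𝓘(ℝ, Plane) e.symm y (EuclideanSpace.single a (1 : ℝ) : Plane)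

/-- The components `T_{ab} = T(∂_a, ∂_b)` in the chart `e` of a covariant 2-tensor field `T`. -/
def comp (e : OpenPartialHomeomorph M Plane)
    (T : (x : M) → TangentSpace 𝓘(ℝ, Plane) x →L[ℝ] TangentSpace 𝓘(ℝ, Plane) x →L[ℝ] ℝ)
    (y : Plane) : Mat :=
  Matrix.of fun a b => T (e.symm y) (coordVec e a y) (coordVec e b y)

/-- The expression of a function in the chart `e`. -/
def loc (e : OpenPartialHomeomorph M Plane) (f : M → ℝ) (y : Plane) : ℝ := f (e.symm y)

variable [IsManifold 𝓘(ℝ, Plane) ω M]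

variable (M) in
/-- Analytic Riemannian metrics on the surface `M`. -/
abbrev Metric : Type _ :=
  Bundle.ContMDiffRiemannianMetric 𝓘(ℝ, Plane) ω Plane (fun x : M => TangentSpace 𝓘(ℝ, Plane) x)

variable (M) in
/-- Asymptotic data `𝒜 = (σ̃, φ̃, λ̃, ṽ, w̃)`: an analytic metric and four analytic functions. -/
structure AsymptoticData where
  σ : Metric M
  φ : M → ℝ
  lam : M → ℝ
  v : M → ℝ
  w : M → ℝ
  analytic_φ : ContMDiff 𝓘(ℝ, Plane) 𝓘(ℝ, ℝ) ω φ
  analytic_lam : ContMDiff 𝓘(ℝ, Plane) 𝓘(ℝ, ℝ) ω lam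
  analytic_v : ContMDiff 𝓘(ℝ, Plane) 𝓘(ℝ, ℝ) ω v
  analytic_w : ContMDiff 𝓘(ℝ, Plane) 𝓘(ℝ, ℝ) ω w

/-- The VTD field `λ̂ = λ̃ - ṽ t`. -/
def AsymptoticData.lamHat (A : AsymptoticData M) (t : ℝ) (x : M) : ℝ := A.lam x - A.v x * t

/-- The VTD field `φ̂ = φ̃ - w̃ t`. -/
def AsymptoticData.phiHat (A : AsymptoticData M) (t : ℝ) (x : M) : ℝ := A.φ x - A.w x * t

/-- The VTD Hamiltonian constraint `Ĉ_0 = -½ e^{-2λ̂} (½ ṽ² - 2 w̃²)`, which is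
`-½ [-k̂_a^b k̂_b^a + τ̂² - 2 p̂²]` for the VTD fields `k̂_a^b = ½ e^{-λ̂} ṽ δ_a^b`,
`τ̂ = e^{-λ̂} ṽ`, `p̂ = -e^{-λ̂} w̃`. -/
def AsymptoticData.hamiltonianVTD (A : AsymptoticData M) (t : ℝ) (x : M) : ℝ :=
  -(1 / 2) * (Real.exp (-2 * A.lamHat t x) * ((1 / 2) * A.v x ^ 2 - 2 * A.w x ^ 2))

/-- The VTD momentum constraints
`Ĉ_a = ½ e^{-λ̂} [-ṽ (∂_a λ̃ - t ∂_a ṽ) + ∂_a ṽ + 4 w̃ (∂_a φ̃ - t ∂_a w̃)]`, which are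
`-[∇̂_b k̂_a^b - ∂_a τ̂ + 2 p̂ ∂_a φ̂]` for the VTD fields. -/
def AsymptoticData.momentumVTD (A : AsymptoticData M) (e : OpenPartialHomeomorph M Plane)
    (a : Fin 2) (t : ℝ) (y : Plane) : ℝ :=
  (1 / 2) * Real.exp (-loc e (A.lamHat t) y) *
    (-loc e A.v y * (pd a (loc e A.lam) y - pd a (loc e A.v) y * t) + pd a (loc e A.v) y
      + 4 * loc e A.w y * (pd a (loc e A.φ) y - pd a (loc e A.w) y * t))

/-- The decay exponents: `εσ'` and `εφ'` belong to the first derivatives of `σ^{ab}` and `φ`. -/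
structure Exponents where
  εσ : ℝ
  εk : ℝ
  εσ' : ℝ
  εφ : ℝ
  εp : ℝ
  εφ' : ℝ

/-- The exponents are positive and satisfy, together with the data,
`ṽ > ε_k > max {ε_σ, ε_σ', ε_p}` and `ε_p > max {ε_φ, ε_φ'}`. -/
structure Exponents.Admissible (ε : Exponents) (A : AsymptoticData M) : Prop where
  pos_σ : 0 < ε.εσ
  pos_k : 0 < ε.εk
  pos_σ' : 0 < ε.εσ'
  pos_φ : 0 < ε.εφ
  pos_p : 0 < ε.εp
  pos_φ' : 0 < ε.εφ'
  k_lt_v : ∀ x, ε.εk < A.v x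
  lt_k : max (max ε.εσ ε.εσ') ε.εp < ε.εk
  lt_p : max ε.εφ ε.εφ' < ε.εp

variable (M) in
/-- Time-dependent fields on the surface: the metric `γ`, the extrinsic curvature `k` (with both
indices down), the scalar field `φ` and its momentum `p`. The shift is zero, and the lapse
`N = e^λ` is fixed by the gauge `λ = λ̂`. -/
structure Fields where
  γ : ℝ → Metric M
  k : ℝ → (x : M) → TangentSpace 𝓘(ℝ, Plane) x →L[ℝ] TangentSpace 𝓘(ℝ, Plane) x →L[ℝ] ℝ
  φ : ℝ → M → ℝ
  p : ℝ → M → ℝ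

namespace Fields

variable (S : Fields M) (A : AsymptoticData M) (e : OpenPartialHomeomorph M Plane)

/-- Components `γ_{ab}`. -/
def gLoc (t : ℝ) (y : Plane) : Mat := comp e (S.γ t).inner y

/-- Components `k_{ab}`. -/
def kLoc (t : ℝ) (y : Plane) : Mat := comp e (S.k t) y

/-- Components of `σ_{ab} = e^{-λ} γ_{ab}`. -/
def sLoc (t : ℝ) (y : Plane) : Mat := Real.exp (-loc e (A.lamHat t) y) • S.gLoc e t y

/-- Components of the inverse metric `σ^{ab} = e^λ γ^{ab}`. -/
def sInv (t : ℝ) (y : Plane) : Mat := Real.exp (loc e (A.lamHat t) y) • (S.gLoc e t y)⁻¹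

/-- `ψ = σ^{ab} ∂_t σ_{ab}`. -/
def psi (t : ℝ) (y : Plane) : ℝ :=
  ∑ a, ∑ b, S.sInv A e t y a b * deriv (fun s => S.sLoc A e s y a b) t

/-- The lapse `N = e^λ`. -/
def lapse (t : ℝ) (y : Plane) : ℝ := Real.exp (loc e (A.lamHat t) y)

/-- The Einstein evolution equations (with zero shift, lapse `N = e^λ`, in the gauge `λ = λ̂`)
at time `t`, at the point with coordinates `y` in the chart `e`. -/
structure EvolutionAt (t : ℝ) (y : Plane) : Prop where
  /-- `∂_t γ_{ab} = -2 N k_{ab}` -/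
  evol_γ : ∀ a b, HasDerivAt (fun s => S.gLoc e s y a b)
    (-2 * lapse A e t y * S.kLoc e t y a b) t
  /-- `∂_t k_{ab} = N R_{ab} - 2 N k_{ac} k_b^c + N τ k_{ab} - ∇_a ∂_b N - 2 N ∂_a φ ∂_b φ` -/
  evol_k : ∀ a b, HasDerivAt (fun s => S.kLoc e s y a b)
    (lapse A e t y * ricci (S.gLoc e t) a b y
      - 2 * lapse A e t y * (∑ c, S.kLoc e t y a c * mixed (S.gLoc e t) (S.kLoc e t) b c y)
      + lapse A e t y * trace (S.gLoc e t) (S.kLoc e t) y * S.kLoc e t y a b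
      - hessian (S.gLoc e t) (lapse A e t) a b y
      - 2 * lapse A e t y * pd a (loc e (S.φ t)) y * pd b (loc e (S.φ t)) y) t
  /-- `∂_t φ = N p` -/
  evol_φ : HasDerivAt (fun s => loc e (S.φ s) y) (lapse A e t y * loc e (S.p t) y) t
  /-- `∂_t p = -½ p ψ - p ∂_t λ + e^λ γ^{ab} (∇_a ∇_b φ + ∂_b φ ∂_a λ)` -/
  evol_p : HasDerivAt (fun s => loc e (S.p s) y)
    (-(1 / 2) * loc e (S.p t) y * S.psi A e t y
      - loc e (S.p t) y * deriv (fun s => loc e (A.lamHat s) y) t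
      + Real.exp (loc e (A.lamHat t) y) * ∑ a, ∑ b, (S.gLoc e t y)⁻¹ a b *
          (hessian (S.gLoc e t) (loc e (S.φ t)) a b y
            + pd b (loc e (S.φ t)) y * pd a (loc e (A.lamHat t)) y)) t

/-! The remainders, that is the solutions of the expansion formulas
`σ^{ab} = σ̃^{ab} + e^{-ε_σ t} δσ^{ab}`,
`k_a^b = e^{-λ} (½ ṽ δ_a^b + e^{-ε_k t} δk_a^b)`,
`φ = φ̃ - w̃ t + e^{-ε_φ t} δφ`, `p = e^{-λ} (-w̃ + e^{-ε_p t} δp)`,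
`∇̃_c σ^{ab} = e^{-ε_σ' t} δσ_{[c]}^{ab}`,
`∂_c φ = ∂_c φ̃ - t ∂_c w̃ + e^{-ε_φ' t} δφ_{[c]}`. -/

variable (ε : Exponents)

/-- `δσ^{ab}` -/
def remσ (a b : Fin 2) (t : ℝ) (y : Plane) : ℝ :=
  Real.exp (ε.εσ * t) * (S.sInv A e t y a b - (comp e A.σ.inner y)⁻¹ a b)

/-- `δφ` -/
def remφ (t : ℝ) (y : Plane) : ℝ :=
  Real.exp (ε.εφ * t) * (loc e (S.φ t) y - loc e (A.phiHat t) y)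

/-- `δk_a^b` -/
def remk (a b : Fin 2) (t : ℝ) (y : Plane) : ℝ :=
  Real.exp (ε.εk * t) * (Real.exp (loc e (A.lamHat t) y) * mixed (S.gLoc e t) (S.kLoc e t) a b y
    - (1 / 2) * loc e A.v y * (1 : Mat) a b)

/-- `δp` -/
def remp (t : ℝ) (y : Plane) : ℝ :=
  Real.exp (ε.εp * t) * (Real.exp (loc e (A.lamHat t) y) * loc e (S.p t) y + loc e A.w y)

/-- `δσ_{[c]}^{ab}` -/
def remDσ (c a b : Fin 2) (t : ℝ) (y : Plane) : ℝ :=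
  Real.exp (ε.εσ' * t) * covDerivUpper (comp e A.σ.inner) (S.sInv A e t) c a b y

/-- `δφ_{[c]}` -/
def remDφ (c : Fin 2) (t : ℝ) (y : Plane) : ℝ :=
  Real.exp (ε.εφ' * t) * (pd c (loc e (S.φ t)) y
    - (pd c (loc e A.φ) y - pd c (loc e A.w) y * t))

end Fields

/-- `f t → 0` as `t → ∞`, locally uniformly on `U` together with the first partial derivatives. -/
def TendsToZeroC1 (f : ℝ → Plane → ℝ) (U : Set Plane) : Prop :=
  TendstoLocallyUniformlyOn f 0 atTop U ∧
    ∀ d, TendstoLocallyUniformlyOn (fun t => pd d (f t)) 0 atTop U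

/-- `S` is, for large `t`, an AVTD solution of the Einstein evolution equations with asymptotic
data `A`: it is analytic in space, solves the evolution equations, and the remainders
`(δσ^{ab}, δφ, δk_a^b, δp, δσ_{[c]}^{ab}, δφ_{[c]})` tend to zero. -/
structure IsAVTDSolution (A : AsymptoticData M) (ε : Exponents) (S : Fields M) : Prop where
  evolution : ∃ T : ℝ, ∀ t, T < t →
    (ContMDiff 𝓘(ℝ, Plane) (𝓘(ℝ, Plane).prod 𝓘(ℝ, Plane →L[ℝ] Plane →L[ℝ] ℝ)) ω
        (fun x => Bundle.TotalSpace.mk' (Plane →L[ℝ] Plane →L[ℝ] ℝ)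
          (E := fun x : M => TangentSpace 𝓘(ℝ, Plane) x →L[ℝ] TangentSpace 𝓘(ℝ, Plane) x →L[ℝ] ℝ)
          x (S.k t x))) ∧
    (∀ x (u z : TangentSpace 𝓘(ℝ, Plane) x), S.k t x u z = S.k t x z u) ∧
    ContMDiff 𝓘(ℝ, Plane) 𝓘(ℝ, ℝ) ω (S.φ t) ∧
    ContMDiff 𝓘(ℝ, Plane) 𝓘(ℝ, ℝ) ω (S.p t) ∧
    ∀ e ∈ atlas Plane M, ∀ y ∈ e.target, S.EvolutionAt A e t y
  tendsto_σ : ∀ e ∈ atlas Plane M, ∀ a b, TendsToZeroC1 (S.remσ A e ε a b) e.target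
  tendsto_φ : ∀ e ∈ atlas Plane M, TendsToZeroC1 (S.remφ A e ε) e.target
  tendsto_k : ∀ e ∈ atlas Plane M, ∀ a b, TendsToZeroC1 (S.remk A e ε a b) e.target
  tendsto_p : ∀ e ∈ atlas Plane M, TendsToZeroC1 (S.remp A e ε) e.target
  tendsto_Dσ : ∀ e ∈ atlas Plane M, ∀ c a b, TendsToZeroC1 (S.remDσ A e ε c a b) e.target
  tendsto_Dφ : ∀ e ∈ atlas Plane M, ∀ c, TendsToZeroC1 (S.remDφ A e ε c) e.target

end Surface

end AVTD

end

/-!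
The limit of the constraint functions follows from the expansions of the fields and from smoothness
in space; the evolution equations themselves are not used. Fix a point of a chart and work along
the filter `nearEnd` of pairs `(t, y)` with `t → ∞` and `y` close to that point. Two growth classes
are enough: `ExpDecay` (decay like some `e^{-ct}`) and `Subexp` (growth slower than every `e^{ct}`,
which covers everything polynomial in `t`). The product of an exponentially decaying and a
subexponential family decays exponentially, so the linear growth in `t` of `∂λ̂` and `∂φ̂` is
harmless.

*Hamiltonian constraint.* The expansion of `σ^{ab}`, together with the `C^1` smallness of
`∇̃_c σ^{ab}`, bounds the partial derivatives of `σ^{ab}` up to order two (`subexpC_sInv`). Since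
`γ = e^λ σ`, the factors `e^λ` cancel in the Christoffel symbols of `γ`
(`christoffel_conformal`), whose first derivatives, and hence the Ricci components `R_{ab}(γ)`, are
therefore subexponential. In `e^{2λ} R(γ) = e^λ σ^{ab} R_{ab}` and
`e^{2λ} |∇φ|² = e^λ σ^{ab} ∂_a φ ∂_b φ` one factor `e^λ` is left, and it decays because `ṽ > 0`
(`expDecay_lapse`). The terms in `k`, `τ` and `p` differ from their VTD values by products that
contain a decaying remainder (`hamiltonian_sub_eq`).

*Momentum constraint.* The pure trace part `½ ṽ δ_a^b` of `e^λ k_a^b` drops out of the connection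
terms of the divergence, so the Christoffel symbols only multiply the decaying remainder of `k`.
All that differs from the VTD constraint is again linear or quadratic in decaying remainders and
their first derivatives (`momentum_sub_eq`).
-/

noncomputable section

namespace AVTD

/-! ### Smoothness of components in a chart -/

section Chart

variable {M : Type*} [TopologicalSpace M] [ChartedSpace Plane M] [IsManifold 𝓘(ℝ, Plane) ω M]
variable {e : OpenPartialHomeomorph M Plane}

lemma contMDiffOn_symm (he : e ∈ atlas Plane M) :
    ContMDiffOn 𝓘(ℝ, Plane) 𝓘(ℝ, Plane) ω e.symm e.target :=
  contMDiffOn_symm_of_mem_maximalAtlas (IsManifold.subset_maximalAtlas he)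

lemma contDiffOn_loc (he : e ∈ atlas Plane M) {f : M → ℝ}
    (hf : ContMDiff 𝓘(ℝ, Plane) 𝓘(ℝ, ℝ) ω f) : ContDiffOn ℝ ∞ (loc e f) e.target := by
  have h : ContMDiffOn 𝓘(ℝ, Plane) 𝓘(ℝ, ℝ) ω (f ∘ e.symm) e.target :=
    hf.comp_contMDiffOn (contMDiffOn_symm he)
  exact h.contDiffOn.of_le le_top

/-- The coordinate vector fields are smooth: `coordVec e a` is the tangent map of `e.symm` applied
to a constant vector field on the plane. -/
lemma contMDiffOn_coordVec (he : e ∈ atlas Plane M) (a : Fin 2) :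
    ContMDiffOn 𝓘(ℝ, Plane) (𝓘(ℝ, Plane).prod 𝓘(ℝ, Plane)) ∞
      (fun y => Bundle.TotalSpace.mk' Plane (E := fun x : M => TangentSpace 𝓘(ℝ, Plane) x)
        (e.symm y) (coordVec e a y)) e.target := by
  have h1 := (contMDiffOn_symm he).contMDiffOn_tangentMapWithin (m := ∞) le_top
    e.open_target.uniqueMDiffOn
  have h2 : ContMDiffOn 𝓘(ℝ, Plane) 𝓘(ℝ, Plane).tangent ∞
      (fun y => (⟨y, (EuclideanSpace.single a (1 : ℝ) : Plane)⟩ : TangentBundle 𝓘(ℝ, Plane) Plane))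
      e.target := by
    exact contMDiffOn_vectorSpace_iff_contDiffOn.2 contDiffOn_const
  refine (h1.comp h2 (fun y hy => hy)).congr fun y hy => ?_
  simp only [Function.comp, tangentMapWithin, coordVec]
  rw [mfderivWithin_of_isOpen e.open_target hy]

lemma contDiffOn_comp (he : e ∈ atlas Plane M)
    {T : (x : M) → TangentSpace 𝓘(ℝ, Plane) x →L[ℝ] TangentSpace 𝓘(ℝ, Plane) x →L[ℝ] ℝ}
    (hT : ContMDiff 𝓘(ℝ, Plane) (𝓘(ℝ, Plane).prod 𝓘(ℝ, Plane →L[ℝ] Plane →L[ℝ] ℝ)) ω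
        (fun x => Bundle.TotalSpace.mk' (Plane →L[ℝ] Plane →L[ℝ] ℝ)
          (E := fun x : M => TangentSpace 𝓘(ℝ, Plane) x →L[ℝ] TangentSpace 𝓘(ℝ, Plane) x →L[ℝ] ℝ)
          x (T x))) (a b : Fin 2) :
    ContDiffOn ℝ ∞ (fun y => comp e T y a b) e.target := by
  have h : ContMDiffOn 𝓘(ℝ, Plane) (𝓘(ℝ, Plane).prod 𝓘(ℝ)) ∞
      (fun y ↦ Bundle.TotalSpace.mk' ℝ (E := Bundle.Trivial M ℝ) (e.symm y)
        (T (e.symm y) (coordVec e a y) (coordVec e b y))) e.target := by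
    apply ContMDiffOn.clm_bundle_apply₂ (F₁ := Plane) (F₂ := Plane)
      (E₁ := fun x : M => TangentSpace 𝓘(ℝ, Plane) x)
      (E₂ := fun x : M => TangentSpace 𝓘(ℝ, Plane) x)
    · exact (hT.of_le le_top).comp_contMDiffOn ((contMDiffOn_symm he).of_le le_top)
    · exact contMDiffOn_coordVec he a
    · exact contMDiffOn_coordVec he b
  intro y hy
  have := h y hy
  rw [Bundle.contMDiffWithinAt_totalSpace] at this
  exact this.2.contDiffWithinAt

lemma comp_symm (g : Metric M) (y : Plane) (a b : Fin 2) :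
    comp e g.inner y a b = comp e g.inner y b a := g.symm _ _ _

/-- The component matrix of a metric is positive definite, because the derivative of `e.symm` is
injective. -/
lemma det_comp_pos (he : e ∈ atlas Plane M) (g : Metric M) {y : Plane} (hy : y ∈ e.target) :
    0 < (comp e g.inner y).det := by
  refine Matrix.PosDef.det_pos (Matrix.PosDef.of_dotProduct_mulVec_pos ?_ fun v hv => ?_)
  · ext a b
    simpa using comp_symm g y b a
  · let D : Plane →L[ℝ] TangentSpace 𝓘(ℝ, Plane) (e.symm y) :=
      mfderiv 𝓘(ℝ, Plane) 𝓘(ℝ, Plane) e.symm y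
    have hinj : Function.Injective D :=
      (mdifferentiable_of_mem_atlas he).symm.mfderiv_injective hy
    have hne : D (WithLp.toLp 2 v) ≠ 0 := fun h0 =>
      hv ((WithLp.toLp_eq_zero 2).1 (hinj (h0.trans (map_zero D).symm)))
    have hsum : D (WithLp.toLp 2 v) = ∑ a, v a • coordVec e a y := by
      have : (WithLp.toLp 2 v : Plane) = ∑ a, v a • EuclideanSpace.single a (1 : ℝ) := by
        ext i; simp [Fin.sum_univ_two]; fin_cases i <;> simp
      rw [this, map_sum]
      simp only [map_smul]
      rfl
    have := g.pos (e.symm y) _ hne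
    rw [hsum] at this
    refine lt_of_lt_of_eq this ?_
    simp [Fin.sum_univ_two, dotProduct, Matrix.mulVec, comp]
    ring

end Chart

/-! ### Rules for partial derivatives -/

section Calculus

variable {f g : Plane → ℝ} {y : Plane} {a : Fin 2}

lemma pd_congr (h : f =ᶠ[𝓝 y] g) : pd a f y = pd a g y := by
  rw [pd, pd, h.fderiv_eq]

@[simp] lemma pd_const (c : ℝ) : pd a (fun _ => c) y = 0 := by simp [pd]

lemma pd_add (hf : DifferentiableAt ℝ f y) (hg : DifferentiableAt ℝ g y) :
    pd a (fun z => f z + g z) y = pd a f y + pd a g y := by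
  rw [pd, fderiv_fun_add hf hg]; rfl

lemma pd_sub (hf : DifferentiableAt ℝ f y) (hg : DifferentiableAt ℝ g y) :
    pd a (fun z => f z - g z) y = pd a f y - pd a g y := by
  rw [pd, fderiv_fun_sub hf hg]; rfl

lemma pd_mul (hf : DifferentiableAt ℝ f y) (hg : DifferentiableAt ℝ g y) :
    pd a (fun z => f z * g z) y = f y * pd a g y + g y * pd a f y := by
  rw [pd, fderiv_fun_mul hf hg]; rfl

lemma pd_const_mul (c : ℝ) : pd a (fun z => c * f z) y = c * pd a f y := by
  have : (fun z => c * f z) = c • f := rfl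
  rw [pd, this, fderiv_const_smul_field]; rfl

lemma pd_mul_const (c : ℝ) : pd a (fun z => f z * c) y = pd a f y * c := by
  simp only [mul_comm _ c, pd_const_mul]

lemma pd_exp (hf : DifferentiableAt ℝ f y) :
    pd a (fun z => Real.exp (f z)) y = Real.exp (f y) * pd a f y := by
  rw [pd, fderiv_exp hf]; rfl

lemma pd_inv (hf : DifferentiableAt ℝ f y) (h0 : f y ≠ 0) :
    pd a (fun z => (f z)⁻¹) y = -(pd a f y * ((f y)⁻¹ * (f y)⁻¹)) := by
  have h := (hasDerivAt_inv h0).comp_hasFDerivAt y hf.hasFDerivAt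
  have : (Inv.inv ∘ f) = fun z => (f z)⁻¹ := rfl
  rw [this] at h
  rw [pd, h.fderiv, pd]
  simp
  field_simp

lemma contDiffAt_pd (hf : ContDiffAt ℝ ∞ f y) : ContDiffAt ℝ ∞ (pd a f) y :=
  (hf.fderiv_right (m := ∞) (by norm_cast)).clm_apply contDiffAt_const

end Calculus

/-! ### Growth classes as time tends to infinity -/

/-- The filter of pairs `(t, y)` with `t → ∞` and `y → x`. Statements that hold along it hold for
all large `t`, uniformly near `x`. -/
def nearEnd (x : Plane) : Filter (ℝ × Plane) := atTop ×ˢ 𝓝 x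

lemma eventually_nearEnd_nhds {x : Plane} {P : ℝ → Plane → Prop}
    (h : ∀ᶠ q in nearEnd x, P q.1 q.2) : ∀ᶠ q in nearEnd x, ∀ᶠ y in 𝓝 q.2, P q.1 y := by
  obtain ⟨p, hp, r, hr, h⟩ := eventually_prod_iff.1 h
  refine eventually_prod_iff.2 ⟨p, hp, _, eventually_eventually_nhds.2 hr, fun ht _ hy => ?_⟩
  exact hy.mono fun z hz => h ht hz

lemma eventually_nearEnd_of_isOpen {x : Plane} {U : Set Plane} (hU : IsOpen U) (hx : x ∈ U)
    {P : ℝ → Plane → Prop} {T : ℝ} (h : ∀ t, T < t → ∀ y ∈ U, P t y) :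
    ∀ᶠ q in nearEnd x, P q.1 q.2 :=
  eventually_prod_iff.2 ⟨_, eventually_gt_atTop T, _, hU.mem_nhds hx, fun ht _ hy => h _ ht _ hy⟩

/-- `f t` grows, near `x`, more slowly than every exponential `e^{ct}`, `c > 0`. -/
def Subexp (x : Plane) (f : ℝ → Plane → ℝ) : Prop :=
  ∀ c : ℝ, 0 < c →
    (fun q : ℝ × Plane => f q.1 q.2) =O[nearEnd x] fun q => Real.exp (c * q.1)

/-- `f t` decays exponentially, at some rate, uniformly near `x`. -/
def ExpDecay (x : Plane) (f : ℝ → Plane → ℝ) : Prop :=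
  ∃ c : ℝ, 0 < c ∧
    (fun q : ℝ × Plane => f q.1 q.2) =O[nearEnd x] fun q => Real.exp (-c * q.1)

section Growth

variable {x : Plane} {f g : ℝ → Plane → ℝ}

lemma tendsto_fst_nearEnd : Tendsto Prod.fst (nearEnd x) atTop := tendsto_fst

lemma tendsto_snd_nearEnd : Tendsto Prod.snd (nearEnd x) (𝓝 x) := tendsto_snd

lemma exp_isBigO_exp {c d : ℝ} (h : c ≤ d) :
    (fun q : ℝ × Plane => Real.exp (c * q.1)) =O[nearEnd x] fun q => Real.exp (d * q.1) := by
  refine Asymptotics.IsBigO.of_bound 1 ?_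
  filter_upwards [tendsto_fst_nearEnd.eventually (eventually_ge_atTop 0)] with q hq
  simp only [Real.norm_eq_abs, Real.abs_exp, one_mul]
  exact Real.exp_le_exp.2 (mul_le_mul_of_nonneg_right h hq)

lemma Subexp.congr (hf : Subexp x f) (h : ∀ᶠ q in nearEnd x, f q.1 q.2 = g q.1 q.2) :
    Subexp x g := fun c hc => (hf c hc).congr' h EventuallyEq.rfl

lemma ExpDecay.congr (hf : ExpDecay x f) (h : ∀ᶠ q in nearEnd x, f q.1 q.2 = g q.1 q.2) :
    ExpDecay x g := let ⟨c, hc, hO⟩ := hf; ⟨c, hc, hO.congr' h EventuallyEq.rfl⟩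

lemma Subexp.of_isBigO_one
    (h : (fun q : ℝ × Plane => f q.1 q.2) =O[nearEnd x] fun _ => (1 : ℝ)) :
    Subexp x f := by
  intro c hc
  refine h.trans ((exp_isBigO_exp (x := x) hc.le).congr_left fun q => ?_)
  simp

lemma Subexp.of_tendsto {r : ℝ} (h : Tendsto (fun q : ℝ × Plane => f q.1 q.2) (nearEnd x) (𝓝 r)) :
    Subexp x f := .of_isBigO_one (h.isBigO_one ℝ)

lemma Subexp.of_continuousAt {f : Plane → ℝ} (hf : ContinuousAt f x) : Subexp x fun _ => f :=
  .of_tendsto (hf.tendsto.comp tendsto_snd_nearEnd)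

lemma Subexp.const (c : ℝ) : Subexp x fun _ _ => c := .of_continuousAt continuousAt_const

lemma Subexp.time : Subexp x fun t _ => t := by
  intro c hc
  have h : (fun t : ℝ => t) =o[atTop] fun t => Real.exp (c * t) := by
    simpa using isLittleO_pow_exp_pos_mul_atTop 1 hc
  exact h.isBigO.comp_tendsto tendsto_fst_nearEnd

lemma Subexp.add (hf : Subexp x f) (hg : Subexp x g) : Subexp x fun t y => f t y + g t y :=
  fun c hc => (hf c hc).add (hg c hc)

lemma Subexp.sub (hf : Subexp x f) (hg : Subexp x g) : Subexp x fun t y => f t y - g t y :=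
  fun c hc => (hf c hc).sub (hg c hc)

lemma Subexp.mul (hf : Subexp x f) (hg : Subexp x g) : Subexp x fun t y => f t y * g t y := by
  intro c hc
  refine ((hf (c / 2) (half_pos hc)).mul (hg (c / 2) (half_pos hc))).congr_right fun q => ?_
  rw [← Real.exp_add]; ring_nf

lemma Subexp.sum {ι : Type*} {s : Finset ι} {F : ι → ℝ → Plane → ℝ}
    (h : ∀ i ∈ s, Subexp x (F i)) : Subexp x fun t y => ∑ i ∈ s, F i t y :=
  fun c hc => Asymptotics.IsBigO.fun_sum fun i hi => h i hi c hc

lemma ExpDecay.subexp (hf : ExpDecay x f) : Subexp x f := by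
  obtain ⟨c, hc, h⟩ := hf
  exact fun d hd => h.trans (exp_isBigO_exp (by linarith))

lemma ExpDecay.add (hf : ExpDecay x f) (hg : ExpDecay x g) :
    ExpDecay x fun t y => f t y + g t y := by
  obtain ⟨c, hc, hf⟩ := hf
  obtain ⟨d, hd, hg⟩ := hg
  exact ⟨min c d, lt_min hc hd, (hf.trans (exp_isBigO_exp (neg_le_neg (min_le_left _ _)))).add
    (hg.trans (exp_isBigO_exp (neg_le_neg (min_le_right _ _))))⟩

lemma ExpDecay.neg (hf : ExpDecay x f) : ExpDecay x fun t y => -f t y :=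
  let ⟨c, hc, h⟩ := hf; ⟨c, hc, h.neg_left⟩

lemma ExpDecay.sub (hf : ExpDecay x f) (hg : ExpDecay x g) :
    ExpDecay x fun t y => f t y - g t y := by
  simpa only [sub_eq_add_neg] using hf.add hg.neg

lemma ExpDecay.mul (hf : ExpDecay x f) (hg : Subexp x g) :
    ExpDecay x fun t y => f t y * g t y := by
  obtain ⟨c, hc, hf⟩ := hf
  refine ⟨c / 2, half_pos hc, (hf.mul (hg (c / 2) (half_pos hc))).congr_right fun q => ?_⟩
  rw [← Real.exp_add]; ring_nf

lemma Subexp.mul_expDecay (hf : Subexp x f) (hg : ExpDecay x g) :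
    ExpDecay x fun t y => f t y * g t y := by
  simpa only [mul_comm] using hg.mul hf

lemma ExpDecay.sum {ι : Type*} {s : Finset ι} {F : ι → ℝ → Plane → ℝ}
    (h : ∀ i ∈ s, ExpDecay x (F i)) : ExpDecay x fun t y => ∑ i ∈ s, F i t y := by
  classical
  induction s using Finset.induction_on with
  | empty => exact ⟨1, one_pos, by simpa using Asymptotics.isBigO_zero _ _⟩
  | insert i s hi ih =>
    simp only [Finset.sum_insert hi]
    exact (h i (Finset.mem_insert_self i s)).add
      (ih fun j hj => h j (Finset.mem_insert_of_mem hj))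

lemma ExpDecay.tendsto (hf : ExpDecay x f) :
    Tendsto (fun q : ℝ × Plane => f q.1 q.2) (nearEnd x) (𝓝 0) := by
  obtain ⟨c, hc, h⟩ := hf
  refine h.trans_tendsto ?_
  have : Tendsto (fun t : ℝ => Real.exp (-c * t)) atTop (𝓝 0) :=
    Real.tendsto_exp_atBot.comp (tendsto_id.const_mul_atTop_of_neg (neg_neg_of_pos hc))
  exact this.comp tendsto_fst_nearEnd

lemma tendstoLocallyUniformlyOn_zero_iff {U : Set Plane} (hU : IsOpen U) :
    TendstoLocallyUniformlyOn f 0 atTop U ↔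
      ∀ x ∈ U, Tendsto (fun q : ℝ × Plane => f q.1 q.2) (nearEnd x) (𝓝 0) := by
  rw [hU.tendstoLocallyUniformlyOn_iff_forall_tendsto]
  refine forall₂_congr fun x _ => ?_
  rw [nearEnd, Metric.tendsto_nhds, Metric.uniformity_basis_dist.tendsto_right_iff]
  simp [dist_comm]

/-- A remainder that tends to zero after multiplication with `e^{ct}` decays exponentially. -/
lemma ExpDecay.of_tendsto_exp_mul {c : ℝ} (hc : 0 < c)
    (h : Tendsto (fun q : ℝ × Plane => Real.exp (c * q.1) * f q.1 q.2) (nearEnd x) (𝓝 0)) :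
    ExpDecay x f := by
  refine ⟨c, hc, ?_⟩
  have := (Asymptotics.isBigO_refl (fun q : ℝ × Plane => Real.exp (-c * q.1)) (nearEnd x)).mul
    (h.isBigO_one ℝ)
  refine this.congr (fun q => ?_) fun q => mul_one _
  rw [← mul_assoc, ← Real.exp_add]
  simp

/-- Multiplication with `e^{ct}` commutes with spatial derivatives, so a `C^1` bound on the rescaled
remainder gives decay of the remainder and of its first derivatives. -/
lemma TendsToZeroC1.expDecay {U : Set Plane} (hU : IsOpen U) (hx : x ∈ U) {c : ℝ}
    (hc : 0 < c) (h : TendsToZeroC1 (fun t y => Real.exp (c * t) * f t y) U) :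
    ExpDecay x f ∧ ∀ d, ExpDecay x fun t => pd d (f t) := by
  refine ⟨.of_tendsto_exp_mul hc ((tendstoLocallyUniformlyOn_zero_iff hU).1 h.1 x hx),
    fun d => .of_tendsto_exp_mul hc ?_⟩
  have := (tendstoLocallyUniformlyOn_zero_iff hU).1 (h.2 d) x hx
  simpa only [pd_const_mul] using this

/-- `e^{u - v t}` decays exponentially where `v > 0`. -/
lemma expDecay_exp {u v : Plane → ℝ} (hu : ContinuousAt u x) (hv : ContinuousAt v x)
    (h : 0 < v x) : ExpDecay x fun t y => Real.exp (u y - v y * t) := by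
  refine ⟨v x / 2, half_pos h, Asymptotics.IsBigO.of_bound (Real.exp (u x + 1)) ?_⟩
  filter_upwards [tendsto_fst_nearEnd.eventually (eventually_ge_atTop 0),
    tendsto_snd_nearEnd.eventually (hu.eventually_lt_const (lt_add_one (u x))),
    tendsto_snd_nearEnd.eventually (hv.eventually_const_lt (half_lt_self h))] with q hq h1 h2
  simp only [Real.norm_eq_abs, Real.abs_exp]
  rw [← Real.exp_add]
  refine Real.exp_le_exp.2 ?_
  nlinarith

end Growth

/-! ### Families with subexponential derivatives -/

/-- For large `t`, `f t` is smooth at the points near `x`, and its partial derivatives of order at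
most `n` grow subexponentially near `x`. -/
def SubexpC (x : Plane) : ℕ → (ℝ → Plane → ℝ) → Prop
  | 0, f => (∀ᶠ q in nearEnd x, ContDiffAt ℝ ∞ (f q.1) q.2) ∧ Subexp x f
  | n + 1, f => ((∀ᶠ q in nearEnd x, ContDiffAt ℝ ∞ (f q.1) q.2) ∧ Subexp x f) ∧
      ∀ d, SubexpC x n fun t => pd d (f t)

namespace SubexpC

variable {x : Plane} {n : ℕ} {f g : ℝ → Plane → ℝ}

lemma contDiffAt (h : SubexpC x n f) : ∀ᶠ q in nearEnd x, ContDiffAt ℝ ∞ (f q.1) q.2 := by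
  cases n with
  | zero => exact h.1
  | succ n => exact h.1.1

lemma subexp (h : SubexpC x n f) : Subexp x f := by
  cases n with
  | zero => exact h.2
  | succ n => exact h.1.2

lemma differentiableAt (h : SubexpC x n f) :
    ∀ᶠ q in nearEnd x, DifferentiableAt ℝ (f q.1) q.2 :=
  h.contDiffAt.mono fun _ hq => hq.differentiableAt (by simp)

lemma partial_deriv (h : SubexpC x (n + 1) f) (d : Fin 2) : SubexpC x n fun t => pd d (f t) := h.2 d

lemma of_succ (h : SubexpC x (n + 1) f) : SubexpC x n f := by
  induction n generalizing f with
  | zero => exact h.1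
  | succ n ih => exact ⟨h.1, fun d => ih (h.2 d)⟩

lemma congr (hf : SubexpC x n f) (h : ∀ᶠ q in nearEnd x, f q.1 q.2 = g q.1 q.2) :
    SubexpC x n g := by
  have key : ∀ {f g : ℝ → Plane → ℝ}, (∀ᶠ q in nearEnd x, f q.1 q.2 = g q.1 q.2) →
      (∀ᶠ q in nearEnd x, ContDiffAt ℝ ∞ (f q.1) q.2) →
      ∀ᶠ q in nearEnd x, ContDiffAt ℝ ∞ (g q.1) q.2 := by
    intro f g h hf
    filter_upwards [hf, eventually_nearEnd_nhds (P := fun t y => f t y = g t y) h] with q h1 h2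
    exact h1.congr_of_eventuallyEq (h2.mono fun _ h => h.symm)
  induction n generalizing f g with
  | zero => exact ⟨key h hf.1, hf.2.congr h⟩
  | succ n ih =>
    refine ⟨⟨key h hf.1.1, hf.1.2.congr h⟩, fun d => ih (hf.2 d) ?_⟩
    filter_upwards [eventually_nearEnd_nhds (P := fun t y => f t y = g t y) h] with q hq
    exact pd_congr hq

lemma const (c : ℝ) : SubexpC x n fun _ _ => c := by
  induction n generalizing c with
  | zero => exact ⟨.of_forall fun _ => contDiffAt_const, .const c⟩
  | succ n ih =>
    refine ⟨⟨.of_forall fun _ => contDiffAt_const, .const c⟩, fun d => ?_⟩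
    exact (ih 0).congr (.of_forall fun _ => (pd_const c).symm)

lemma time : SubexpC x n fun t _ => t := by
  cases n with
  | zero => exact ⟨.of_forall fun _ => contDiffAt_const, .time⟩
  | succ n =>
    refine ⟨⟨.of_forall fun _ => contDiffAt_const, .time⟩, fun d => ?_⟩
    exact (const 0).congr (.of_forall fun q => (pd_const q.1).symm)

lemma of_contDiffAt {f : Plane → ℝ} (hf : ∀ᶠ y in 𝓝 x, ContDiffAt ℝ ∞ f y) :
    SubexpC x n fun _ => f := by
  have hs := tendsto_snd_nearEnd.eventually hf
  have hc := Subexp.of_continuousAt hf.self_of_nhds.continuousAt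
  induction n generalizing f with
  | zero => exact ⟨hs, hc⟩
  | succ n ih =>
    have hd : ∀ d, ∀ᶠ y in 𝓝 x, ContDiffAt ℝ ∞ (pd d f) y :=
      fun d => hf.mono fun _ h => contDiffAt_pd h
    exact ⟨⟨hs, hc⟩, fun d => ih (hd d) (tendsto_snd_nearEnd.eventually (hd d))
      (.of_continuousAt (hd d).self_of_nhds.continuousAt)⟩

lemma add (hf : SubexpC x n f) (hg : SubexpC x n g) : SubexpC x n fun t y => f t y + g t y := by
  have key : ∀ᶠ q in nearEnd x, ContDiffAt ℝ ∞ (fun y => f q.1 y + g q.1 y) q.2 := by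
    filter_upwards [hf.contDiffAt, hg.contDiffAt] with q h1 h2 using h1.add h2
  induction n generalizing f g with
  | zero => exact ⟨key, hf.2.add hg.2⟩
  | succ n ih =>
    refine ⟨⟨key, hf.1.2.add hg.1.2⟩, fun d => (ih (hf.2 d) (hg.2 d) ?_).congr ?_⟩
    · filter_upwards [(hf.2 d).contDiffAt, (hg.2 d).contDiffAt] with q h1 h2 using h1.add h2
    · filter_upwards [hf.differentiableAt, hg.differentiableAt] with q h1 h2
      exact (pd_add h1 h2).symm

lemma mul (hf : SubexpC x n f) (hg : SubexpC x n g) : SubexpC x n fun t y => f t y * g t y := by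
  have key : ∀ {f g : ℝ → Plane → ℝ}, (∀ᶠ q in nearEnd x, ContDiffAt ℝ ∞ (f q.1) q.2) →
      (∀ᶠ q in nearEnd x, ContDiffAt ℝ ∞ (g q.1) q.2) →
      ∀ᶠ q in nearEnd x, ContDiffAt ℝ ∞ (fun y => f q.1 y * g q.1 y) q.2 := fun hf hg => by
    filter_upwards [hf, hg] with q h1 h2 using h1.mul h2
  induction n generalizing f g with
  | zero => exact ⟨key hf.contDiffAt hg.contDiffAt, hf.2.mul hg.2⟩
  | succ n ih =>
    refine ⟨⟨key hf.contDiffAt hg.contDiffAt, hf.1.2.mul hg.1.2⟩, fun d =>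
      ((ih hf.of_succ (hg.2 d)).add (ih hg.of_succ (hf.2 d))).congr ?_⟩
    filter_upwards [hf.differentiableAt, hg.differentiableAt] with q h1 h2
    exact (pd_mul h1 h2).symm

lemma neg (hf : SubexpC x n f) : SubexpC x n fun t y => -f t y := by
  simpa using (const (-1)).mul hf

lemma sub (hf : SubexpC x n f) (hg : SubexpC x n g) : SubexpC x n fun t y => f t y - g t y := by
  simpa only [sub_eq_add_neg] using hf.add hg.neg

lemma sum {ι : Type*} {s : Finset ι} {F : ι → ℝ → Plane → ℝ}
    (h : ∀ i ∈ s, SubexpC x n (F i)) : SubexpC x n fun t y => ∑ i ∈ s, F i t y := by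
  classical
  induction s using Finset.induction_on with
  | empty => simpa using const 0
  | insert i s hi ih =>
    simp only [Finset.sum_insert hi]
    exact (h i (Finset.mem_insert_self i s)).add
      (ih fun j hj => h j (Finset.mem_insert_of_mem hj))

/-- Besides `f ≠ 0`, the reciprocal itself has to be subexponential: a subexponential `f` may decay
fast. -/
lemma inv (hf : SubexpC x n f) (h0 : ∀ᶠ q in nearEnd x, f q.1 q.2 ≠ 0)
    (hb : Subexp x fun t y => (f t y)⁻¹) : SubexpC x n fun t y => (f t y)⁻¹ := by
  have key : ∀ᶠ q in nearEnd x, ContDiffAt ℝ ∞ (fun y => (f q.1 y)⁻¹) q.2 := by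
    filter_upwards [hf.contDiffAt, h0] with q h1 h2 using h1.inv h2
  induction n with
  | zero => exact ⟨key, hb⟩
  | succ n ih =>
    have hi := ih hf.of_succ
    refine ⟨⟨key, hb⟩, fun d => ((hf.2 d).mul (hi.mul hi)).neg.congr ?_⟩
    filter_upwards [hf.differentiableAt, h0] with q h1 h2
    exact (pd_inv h1 h2).symm

lemma of_expDecay (hs : ∀ᶠ q in nearEnd x, ContDiffAt ℝ ∞ (f q.1) q.2)
    (h : ExpDecay x f ∧ ∀ d, ExpDecay x fun t => pd d (f t)) : SubexpC x 1 f :=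
  ⟨⟨hs, h.1.subexp⟩, fun d => ⟨hs.mono fun _ hq => contDiffAt_pd hq, (h.2 d).subexp⟩⟩

end SubexpC

/-! ### Curvature of a family of metrics -/

section Geometry

variable {x : Plane} {n : ℕ}

lemma eventually_target {M : Type*} [TopologicalSpace M] {e : OpenPartialHomeomorph M Plane}
    (hx : x ∈ e.target) : ∀ᶠ q in nearEnd x, q.2 ∈ e.target :=
  tendsto_snd_nearEnd.eventually (e.open_target.mem_nhds hx)

lemma inv_apply_fin_two (m : Mat) (a b : Fin 2) :
    m⁻¹ a b = (m 0 0 * m 1 1 - m 0 1 * m 1 0)⁻¹ * !![m 1 1, -m 0 1; -m 1 0, m 0 0] a b := by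
  rw [Matrix.inv_def, Matrix.adjugate_fin_two, Matrix.det_fin_two, Ring.inverse_eq_inv']
  rfl

lemma contDiffAt_inv_apply {g : Plane → Mat} {y : Plane}
    (hg : ∀ a b, ContDiffAt ℝ ∞ (fun z => g z a b) y) (h0 : (g y).det ≠ 0) (a b : Fin 2) :
    ContDiffAt ℝ ∞ (fun z => (g z)⁻¹ a b) y := by
  simp only [inv_apply_fin_two]
  rw [Matrix.det_fin_two] at h0
  refine ((((hg 0 0).mul (hg 1 1)).sub ((hg 0 1).mul (hg 1 0))).inv h0).mul ?_
  fin_cases a <;> fin_cases b <;> simp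
  exacts [hg 1 1, (hg 0 1).neg, (hg 1 0).neg, hg 0 0]

lemma SubexpC.matrix_inv {G : ℝ → Plane → Mat} (hG : ∀ a b, SubexpC x n fun t y => G t y a b)
    (h0 : ∀ᶠ q in nearEnd x, (G q.1 q.2).det ≠ 0)
    (hb : Subexp x fun t y => (G t y).det⁻¹) (a b : Fin 2) :
    SubexpC x n fun t y => (G t y)⁻¹ a b := by
  simp only [inv_apply_fin_two]
  simp only [Matrix.det_fin_two] at h0 hb
  refine ((((hG 0 0).mul (hG 1 1)).sub ((hG 0 1).mul (hG 1 0))).inv h0 hb).mul ?_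
  fin_cases a <;> fin_cases b <;> simp
  exacts [hG 1 1, (hG 0 1).neg, (hG 1 0).neg, hG 0 0]

lemma SubexpC.christoffel {G : ℝ → Plane → Mat}
    (hG : ∀ a b, SubexpC x (n + 1) fun t y => G t y a b)
    (hi : ∀ a b, SubexpC x n fun t y => (G t y)⁻¹ a b) (c a b : Fin 2) :
    SubexpC x n fun t => AVTD.christoffel (G t) c a b :=
  (SubexpC.const (1 / 2)).mul <| SubexpC.sum fun d _ => (hi c d).mul <|
    (((hG d b).partial_deriv a).add ((hG d a).partial_deriv b)).sub ((hG a b).partial_deriv d)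

lemma SubexpC.ricci {G : ℝ → Plane → Mat}
    (hG : ∀ c a b, SubexpC x 1 fun t => AVTD.christoffel (G t) c a b) (a b : Fin 2) :
    SubexpC x 0 fun t => AVTD.ricci (G t) a b :=
  ((SubexpC.sum fun c _ => (hG c a b).partial_deriv c).sub
    (SubexpC.sum fun c _ => (hG c a c).partial_deriv b)).add <|
    SubexpC.sum fun c _ => SubexpC.sum fun d _ =>
      ((hG c c d).of_succ.mul (hG d a b).of_succ).sub ((hG c b d).of_succ.mul (hG d a c).of_succ)

/-- Behaviour of the Christoffel symbols under the conformal change `g = e^u s`. The factors `e^u`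
cancel, so that only the derivative of `u` is left. -/
lemma christoffel_conformal {g s : Plane → Mat} {u : Plane → ℝ} {y : Plane}
    (hgs : ∀ z, g z = Real.exp (u z) • s z)
    (hs : ∀ a b, DifferentiableAt ℝ (fun z => s z a b) y) (hu : DifferentiableAt ℝ u y)
    (c a b : Fin 2) :
    christoffel g c a b y = christoffel s c a b y + (1 / 2) * ∑ d, (s y)⁻¹ c d *
      (s y d b * pd a u y + s y d a * pd b u y - s y a b * pd d u y) := by
  have hpd : ∀ d a b, pd d (fun z => g z a b) y
      = Real.exp (u y) * (pd d (fun z => s z a b) y + s y a b * pd d u y) := by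
    intro d a b
    simp only [hgs, Matrix.smul_apply, smul_eq_mul]
    rw [pd_mul hu.exp (hs a b), pd_exp hu]
    ring
  have hinv : ∀ a b, (g y)⁻¹ a b = (Real.exp (u y))⁻¹ * (s y)⁻¹ a b := by
    intro a b
    have hk := (Real.exp_pos (u y)).ne'
    simp only [hgs, inv_apply_fin_two, Matrix.smul_apply, smul_eq_mul]
    generalize Real.exp (u y) = k at hk
    rw [show k * s y 0 0 * (k * s y 1 1) - k * s y 0 1 * (k * s y 1 0)
      = k * (k * (s y 0 0 * s y 1 1 - s y 0 1 * s y 1 0)) by ring, mul_inv, mul_inv]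
    -- The reciprocal determinant enters linearly; its value is irrelevant, even for singular `s y`.
    generalize (s y 0 0 * s y 1 1 - s y 0 1 * s y 1 0)⁻¹ = D
    fin_cases a <;> fin_cases b <;> simp <;> field_simp
  have := (Real.exp_pos (u y)).ne'
  simp only [christoffel, hpd, hinv, Fin.sum_univ_two]
  field_simp
  ring

end Geometry

/-! ### The rescaled metric and its Christoffel symbols -/

section Fields

variable {M : Type*} [TopologicalSpace M] [ChartedSpace Plane M] [IsManifold 𝓘(ℝ, Plane) ω M]
variable {A : AsymptoticData M} {ε : Exponents} {S : Fields M}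
  {e : OpenPartialHomeomorph M Plane} {x : Plane}

lemma eventually_of_contDiffOn {f : Plane → ℝ} {U : Set Plane} (hU : IsOpen U)
    (hf : ContDiffOn ℝ ∞ f U) (hx : x ∈ U) : ∀ᶠ y in 𝓝 x, ContDiffAt ℝ ∞ f y := by
  filter_upwards [hU.mem_nhds hx] with y hy using hf.contDiffAt (hU.mem_nhds hy)

lemma subexpC_loc (he : e ∈ atlas Plane M) (hx : x ∈ e.target) {n : ℕ} {f : M → ℝ}
    (hf : ContMDiff 𝓘(ℝ, Plane) 𝓘(ℝ, ℝ) ω f) : SubexpC x n fun _ => loc e f :=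
  .of_contDiffAt (eventually_of_contDiffOn e.open_target (contDiffOn_loc he hf) hx)

lemma subexpC_lamHat (he : e ∈ atlas Plane M) (hx : x ∈ e.target) (n : ℕ) :
    SubexpC x n fun t => loc e (A.lamHat t) :=
  (subexpC_loc he hx A.analytic_lam).sub ((subexpC_loc he hx A.analytic_v).mul .time)

lemma contDiffAt_lamHat (he : e ∈ atlas Plane M) (hx : x ∈ e.target) (t : ℝ) :
    ContDiffAt ℝ ∞ (loc e (A.lamHat t)) x :=
  (contDiffOn_loc he (A.analytic_lam.sub
    (A.analytic_v.mul contMDiff_const))).contDiffAt (e.open_target.mem_nhds hx)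

lemma pd_lamHat (he : e ∈ atlas Plane M) (hx : x ∈ e.target) (t : ℝ) (a : Fin 2) :
    pd a (loc e (A.lamHat t)) x = pd a (loc e A.lam) x - pd a (loc e A.v) x * t := by
  have hd : ∀ {f : M → ℝ}, ContMDiff 𝓘(ℝ, Plane) 𝓘(ℝ, ℝ) ω f →
      DifferentiableAt ℝ (loc e f) x := fun hf =>
    ((contDiffOn_loc he hf).contDiffAt (e.open_target.mem_nhds hx)).differentiableAt (by simp)
  rw [← pd_mul_const, ← pd_sub (hd A.analytic_lam) ((hd A.analytic_v).mul_const t)]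
  rfl

/-- The gauge `λ = λ̃ - ṽ t` with `ṽ > 0` makes the conformal factor decay. -/
lemma expDecay_lapse (hε : ε.Admissible A) (he : e ∈ atlas Plane M) (hx : x ∈ e.target) :
    ExpDecay x fun t y => Real.exp (loc e (A.lamHat t) y) := by
  have hc : ∀ {f : M → ℝ}, ContMDiff 𝓘(ℝ, Plane) 𝓘(ℝ, ℝ) ω f → ContinuousAt (loc e f) x :=
    fun hf => ((contDiffOn_loc he hf).contDiffAt (e.open_target.mem_nhds hx)).continuousAt
  exact expDecay_exp (hc A.analytic_lam) (hc A.analytic_v) (hε.pos_k.trans (hε.k_lt_v _))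

lemma contDiffAt_comp_metric (he : e ∈ atlas Plane M) (g : Metric M) {y : Plane}
    (hy : y ∈ e.target) (a b : Fin 2) : ContDiffAt ℝ ∞ (fun z => comp e g.inner z a b) y :=
  (contDiffOn_comp he g.contMDiff a b).contDiffAt (e.open_target.mem_nhds hy)

lemma contDiffAt_inv_comp_metric (he : e ∈ atlas Plane M) (g : Metric M) {y : Plane}
    (hy : y ∈ e.target) (a b : Fin 2) :
    ContDiffAt ℝ ∞ (fun z => (comp e g.inner z)⁻¹ a b) y :=
  contDiffAt_inv_apply (contDiffAt_comp_metric he g hy) (det_comp_pos he g hy).ne' a b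

lemma contDiffAt_sInv (he : e ∈ atlas Plane M) (t : ℝ) {y : Plane} (hy : y ∈ e.target)
    (a b : Fin 2) : ContDiffAt ℝ ∞ (fun z => S.sInv A e t z a b) y :=
  (contDiffAt_lamHat he hy t).exp.mul (contDiffAt_inv_comp_metric he (S.γ t) hy a b)

lemma sInv_mul_sLoc (he : e ∈ atlas Plane M) (t : ℝ) {y : Plane} (hy : y ∈ e.target) :
    S.sInv A e t y * S.sLoc A e t y = 1 := by
  rw [Fields.sInv, Fields.sLoc, Matrix.smul_mul, Matrix.mul_smul, smul_smul, ← Real.exp_add,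
    add_neg_cancel, Real.exp_zero, one_smul]
  exact Matrix.nonsing_inv_mul _ (det_comp_pos he (S.γ t) hy).ne'.isUnit

lemma inv_sLoc (he : e ∈ atlas Plane M) (t : ℝ) {y : Plane} (hy : y ∈ e.target) :
    (S.sLoc A e t y)⁻¹ = S.sInv A e t y :=
  Matrix.inv_eq_left_inv (sInv_mul_sLoc he t hy)

lemma inv_sInv (he : e ∈ atlas Plane M) (t : ℝ) {y : Plane} (hy : y ∈ e.target) :
    (S.sInv A e t y)⁻¹ = S.sLoc A e t y :=
  Matrix.inv_eq_right_inv (sInv_mul_sLoc he t hy)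

lemma gLoc_eq (t : ℝ) (y : Plane) :
    S.gLoc e t y = Real.exp (loc e (A.lamHat t) y) • S.sLoc A e t y := by
  rw [Fields.sLoc, smul_smul, ← Real.exp_add, add_neg_cancel, Real.exp_zero, one_smul]

lemma inv_gLoc_eq (t : ℝ) (y : Plane) :
    (S.gLoc e t y)⁻¹ = (Real.exp (loc e (A.lamHat t) y))⁻¹ • S.sInv A e t y := by
  rw [Fields.sInv, smul_smul, inv_mul_cancel₀ (Real.exp_pos _).ne', one_smul]

lemma subexpC_christoffel_data (he : e ∈ atlas Plane M) (hx : x ∈ e.target) (n : ℕ)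
    (c a b : Fin 2) : SubexpC x n fun _ => christoffel (comp e A.σ.inner) c a b := by
  have hev := e.open_target.mem_nhds hx
  exact SubexpC.christoffel (G := fun _ => comp e A.σ.inner)
    (fun a b => .of_contDiffAt (.mono hev fun y hy => contDiffAt_comp_metric he A.σ hy a b))
    (fun a b => .of_contDiffAt (.mono hev fun y hy => contDiffAt_inv_comp_metric he A.σ hy a b))
    c a b

lemma expDecay_sInv_sub (hε : ε.Admissible A) (hS : IsAVTDSolution A ε S)
    (he : e ∈ atlas Plane M) (hx : x ∈ e.target) (a b : Fin 2) :
    ExpDecay x (fun t y => S.sInv A e t y a b - (comp e A.σ.inner y)⁻¹ a b) ∧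
    ∀ d, ExpDecay x fun t =>
      pd d (fun y => S.sInv A e t y a b - (comp e A.σ.inner y)⁻¹ a b) :=
  (hS.tendsto_σ e he a b).expDecay e.open_target hx hε.pos_σ

/-- The remainder `δσ_{[c]}^{ab}` controls the second derivatives of `σ^{ab}`: it gives
`∂_c σ^{ab}` in terms of `σ^{ab}` and the Christoffel symbols of the data, up to an error
that is small together with its first derivatives. -/
lemma subexpC_sInv (hε : ε.Admissible A) (hS : IsAVTDSolution A ε S)
    (he : e ∈ atlas Plane M) (hx : x ∈ e.target) (a b : Fin 2) :
    SubexpC x 2 fun t y => S.sInv A e t y a b := by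
  have hev := eventually_target hx
  have h1 : ∀ a b, SubexpC x 1 fun t y => S.sInv A e t y a b := by
    intro a b
    have hσ : SubexpC x 1 fun _ y => (comp e A.σ.inner y)⁻¹ a b :=
      .of_contDiffAt (.mono (e.open_target.mem_nhds hx)
        fun y hy => contDiffAt_inv_comp_metric he A.σ hy a b)
    refine ((SubexpC.of_expDecay ?_ (expDecay_sInv_sub hε hS he hx a b)).add hσ).congr
      (.of_forall fun q => sub_add_cancel _ _)
    filter_upwards [hev] with q hq
    exact (contDiffAt_sInv he q.1 hq a b).sub (contDiffAt_inv_comp_metric he A.σ hq a b)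
  refine ⟨(h1 a b).1, fun c => ?_⟩
  have hΓ : SubexpC x 1 fun t y => ∑ d,
      (christoffel (comp e A.σ.inner) a c d y * S.sInv A e t y d b
        + christoffel (comp e A.σ.inner) b c d y * S.sInv A e t y a d) :=
    SubexpC.sum fun d _ => ((subexpC_christoffel_data he hx 1 a c d).mul (h1 d b)).add
      ((subexpC_christoffel_data he hx 1 b c d).mul (h1 a d))
  have hD : SubexpC x 1 fun t => covDerivUpper (comp e A.σ.inner) (S.sInv A e t) c a b := by
    refine .of_expDecay ?_ ((hS.tendsto_Dσ e he c a b).expDecay e.open_target hx hε.pos_σ')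
    filter_upwards [hev, hΓ.contDiffAt] with q hq h
    exact (contDiffAt_pd (contDiffAt_sInv he q.1 hq a b)).add h
  exact (hD.sub hΓ).congr (.of_forall fun q => add_sub_cancel_right _ _)

/-- `σ_{ab}` is the inverse of `σ^{ab}`, whose determinant tends to that of `σ̃^{ab}`, hence stays
away from zero. -/
lemma subexpC_sLoc (hε : ε.Admissible A) (hS : IsAVTDSolution A ε S)
    (he : e ∈ atlas Plane M) (hx : x ∈ e.target) (a b : Fin 2) :
    SubexpC x 2 fun t y => S.sLoc A e t y a b := by
  have hlim : ∀ a b, Tendsto (fun q : ℝ × Plane => S.sInv A e q.1 q.2 a b) (nearEnd x)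
      (𝓝 ((comp e A.σ.inner x)⁻¹ a b)) := by
    intro a b
    have := (expDecay_sInv_sub hε hS he hx a b).1.tendsto.add
      ((contDiffAt_inv_comp_metric he A.σ hx a b).continuousAt.tendsto.comp tendsto_snd_nearEnd)
    simpa using this
  have hdet : Tendsto (fun q : ℝ × Plane => (S.sInv A e q.1 q.2).det) (nearEnd x)
      (𝓝 ((comp e A.σ.inner x)⁻¹).det) := by
    simp only [Matrix.det_fin_two]
    exact ((hlim 0 0).mul (hlim 1 1)).sub ((hlim 0 1).mul (hlim 1 0))
  have h0 : ((comp e A.σ.inner x)⁻¹).det ≠ 0 :=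
    (Matrix.isUnit_nonsing_inv_det _ (det_comp_pos he A.σ hx).ne'.isUnit).ne_zero
  refine (SubexpC.matrix_inv (subexpC_sInv hε hS he hx) (hdet.eventually_ne h0)
    (.of_tendsto (hdet.inv₀ h0)) a b).congr ?_
  filter_upwards [eventually_target hx] with q hq
  rw [inv_sInv he q.1 hq]

/-- Although `γ_{ab}` degenerates as `t → ∞`, its Christoffel symbols and their first derivatives
grow subexponentially. -/
lemma subexpC_christoffel (hε : ε.Admissible A) (hS : IsAVTDSolution A ε S)
    (he : e ∈ atlas Plane M) (hx : x ∈ e.target) (c a b : Fin 2) :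
    SubexpC x 1 fun t => christoffel (S.gLoc e t) c a b := by
  have hs := subexpC_sLoc hε hS he hx
  have hlam := subexpC_lamHat (A := A) he hx 2
  have hi : ∀ a b, SubexpC x 1 fun t y => (S.sLoc A e t y)⁻¹ a b := fun a b =>
    (subexpC_sInv hε hS he hx a b).of_succ.congr <| by
      filter_upwards [eventually_target hx] with q hq
      rw [inv_sLoc he q.1 hq]
  refine ((SubexpC.christoffel hs hi c a b).add ((SubexpC.const (1 / 2)).mul
    (SubexpC.sum (s := Finset.univ) fun d _ => (hi c d).mul
      ((((hs d b).of_succ.mul (hlam.partial_deriv a)).add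
        ((hs d a).of_succ.mul (hlam.partial_deriv b))).sub
        ((hs a b).of_succ.mul (hlam.partial_deriv d)))))).congr ?_
  have hd := fun a b => (hs a b).differentiableAt
  filter_upwards [hd 0 0, hd 0 1, hd 1 0, hd 1 1, hlam.differentiableAt] with q h1 h2 h3 h4 h5
  refine (christoffel_conformal (gLoc_eq q.1) (fun a b => ?_) h5 c a b).symm
  fin_cases a <;> fin_cases b <;> assumption

end Fields

/-! ### The constraint functions -/

section Constraints

variable {M : Type*} [TopologicalSpace M] [ChartedSpace Plane M] [IsManifold 𝓘(ℝ, Plane) ω M]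
variable {A : AsymptoticData M} {ε : Exponents} {S : Fields M}
  {e : OpenPartialHomeomorph M Plane} {x : Plane}

variable (S A e) in
/-- The deviation `e^λ k_a^b - ½ ṽ δ_a^b` of the rescaled extrinsic curvature from its limit. -/
def kDev (t : ℝ) (a b : Fin 2) (y : Plane) : ℝ :=
  Real.exp (loc e (A.lamHat t) y) * mixed (S.gLoc e t) (S.kLoc e t) a b y
    - (1 / 2) * loc e A.v y * (1 : Mat) a b

variable (S A e) in
/-- The deviation `e^λ p + w̃` of the rescaled momentum from its limit. -/
def pDev (t : ℝ) (y : Plane) : ℝ :=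
  Real.exp (loc e (A.lamHat t) y) * loc e (S.p t) y + loc e A.w y

variable (S A e) in
/-- The deviation `∂_c φ - ∂_c φ̂` of the gradient of the scalar field. -/
def dphiDev (t : ℝ) (c : Fin 2) (y : Plane) : ℝ :=
  pd c (loc e (S.φ t)) y - (pd c (loc e A.φ) y - pd c (loc e A.w) y * t)

lemma mixed_eq (t : ℝ) (a b : Fin 2) (y : Plane) :
    mixed (S.gLoc e t) (S.kLoc e t) a b y = Real.exp (-loc e (A.lamHat t) y) *
      (kDev A S e t a b y + (1 / 2) * loc e A.v y * (1 : Mat) a b) := by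
  rw [kDev, sub_add_cancel, ← mul_assoc, ← Real.exp_add, neg_add_cancel, Real.exp_zero, one_mul]

lemma trace_eq (t : ℝ) (y : Plane) :
    trace (S.gLoc e t) (S.kLoc e t) y = Real.exp (-loc e (A.lamHat t) y) *
      (kDev A S e t 0 0 y + kDev A S e t 1 1 y + loc e A.v y) := by
  have : trace (S.gLoc e t) (S.kLoc e t) y = ∑ a, mixed (S.gLoc e t) (S.kLoc e t) a a y := rfl
  rw [this, Fin.sum_univ_two, mixed_eq (A := A), mixed_eq (A := A), Matrix.one_apply_eq,
    Matrix.one_apply_eq]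
  ring

lemma p_eq (t : ℝ) (y : Plane) :
    loc e (S.p t) y = Real.exp (-loc e (A.lamHat t) y) * (pDev A S e t y - loc e A.w y) := by
  rw [pDev, add_sub_cancel_right, ← mul_assoc, ← Real.exp_add, neg_add_cancel, Real.exp_zero,
    one_mul]

lemma dphi_eq (t : ℝ) (c : Fin 2) (y : Plane) :
    pd c (loc e (S.φ t)) y
      = dphiDev A S e t c y + (pd c (loc e A.φ) y - pd c (loc e A.w) y * t) := by
  rw [dphiDev, sub_add_cancel]

lemma expDecay_kDev (hε : ε.Admissible A) (hS : IsAVTDSolution A ε S)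
    (he : e ∈ atlas Plane M) (hx : x ∈ e.target) (a b : Fin 2) :
    ExpDecay x (fun t => kDev A S e t a b) ∧ ∀ d, ExpDecay x fun t => pd d (kDev A S e t a b) :=
  (hS.tendsto_k e he a b).expDecay e.open_target hx hε.pos_k

lemma expDecay_pDev (hε : ε.Admissible A) (hS : IsAVTDSolution A ε S)
    (he : e ∈ atlas Plane M) (hx : x ∈ e.target) : ExpDecay x (pDev A S e) :=
  ((hS.tendsto_p e he).expDecay e.open_target hx hε.pos_p).1

lemma expDecay_dphiDev (hε : ε.Admissible A) (hS : IsAVTDSolution A ε S)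
    (he : e ∈ atlas Plane M) (hx : x ∈ e.target) (c : Fin 2) :
    ExpDecay x fun t => dphiDev A S e t c :=
  ((hS.tendsto_Dφ e he c).expDecay e.open_target hx hε.pos_φ').1

lemma differentiableAt_kDev (hS : IsAVTDSolution A ε S) (he : e ∈ atlas Plane M)
    (hx : x ∈ e.target) (a b : Fin 2) :
    ∀ᶠ q in nearEnd x, DifferentiableAt ℝ (kDev A S e q.1 a b) q.2 := by
  obtain ⟨T, hT⟩ := hS.evolution
  refine eventually_nearEnd_of_isOpen (P := fun t y => DifferentiableAt ℝ (kDev A S e t a b) y)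
    e.open_target hx (T := T) fun t ht y hy => ?_
  have hk : ∀ a b, ContDiffAt ℝ ∞ (fun z => S.kLoc e t z a b) y := fun a b =>
    (contDiffOn_comp he (hT t ht).1 a b).contDiffAt (e.open_target.mem_nhds hy)
  have hm : ContDiffAt ℝ ∞ (mixed (S.gLoc e t) (S.kLoc e t) a b) y :=
    ContDiffAt.sum fun c _ => (contDiffAt_inv_comp_metric he (S.γ t) hy b c).mul (hk a c)
  have hv := (contDiffOn_loc he A.analytic_v).contDiffAt (e.open_target.mem_nhds hy)
  have : ContDiffAt ℝ ∞ (kDev A S e t a b) y :=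
    ((contDiffAt_lamHat he hy t).exp.mul hm).sub ((contDiffAt_const.mul hv).mul contDiffAt_const)
  exact this.differentiableAt (by simp)

lemma pd_exp_neg_mul {u f : Plane → ℝ} {y : Plane} {a : Fin 2} (hu : DifferentiableAt ℝ u y)
    (hf : DifferentiableAt ℝ f y) : pd a (fun z => Real.exp (-u z) * f z) y
      = Real.exp (-u y) * (pd a f y - f y * pd a u y) := by
  have hn : pd a (fun z => -u z) y = -pd a u y := by
    simpa using pd_const_mul (f := u) (y := y) (a := a) (-1)
  have hu' : DifferentiableAt ℝ (fun z => -u z) y := hu.neg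
  rw [pd_mul hu'.exp hf, pd_exp hu', hn]
  ring

/-- The rescaled Hamiltonian constraint. The curvature of `γ = e^λ σ` and the gradient of `φ`
appear with the decaying factor `e^λ`, and the velocity terms of the VTD fields cancel. -/
lemma hamiltonian_sub_eq (t : ℝ) (y : Plane) :
    Real.exp (2 * loc e (A.lamHat t) y) *
        (hamiltonianC (S.gLoc e t) (S.kLoc e t) (loc e (S.φ t)) (loc e (S.p t)) y
          - loc e (A.hamiltonianVTD t) y) =
    -(1 / 2) * (Real.exp (loc e (A.lamHat t) y) *
          (∑ a, ∑ b, S.sInv A e t y a b *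
            (ricci (S.gLoc e t) a b y - 2 * (pd a (loc e (S.φ t)) y * pd b (loc e (S.φ t)) y)))
        - (∑ a, ∑ b, kDev A S e t a b y * kDev A S e t b a y)
        + (kDev A S e t 0 0 y + kDev A S e t 1 1 y) *
          (loc e A.v y + (kDev A S e t 0 0 y + kDev A S e t 1 1 y))
        + pDev A S e t y * (4 * loc e A.w y - 2 * pDev A S e t y)) := by
  have hV : loc e (A.hamiltonianVTD t) y = -(1 / 2) * (Real.exp (-2 * loc e (A.lamHat t) y) *
    ((1 / 2) * loc e A.v y ^ 2 - 2 * loc e A.w y ^ 2)) := rfl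
  have h2 : Real.exp (2 * loc e (A.lamHat t) y) = Real.exp (loc e (A.lamHat t) y) ^ 2 := by
    rw [← Real.exp_nat_mul]; norm_num
  have h3 : Real.exp (-2 * loc e (A.lamHat t) y) = (Real.exp (loc e (A.lamHat t) y) ^ 2)⁻¹ := by
    rw [← h2, ← Real.exp_neg]; ring_nf
  have h0 := (Real.exp_pos (loc e (A.lamHat t) y)).ne'
  rw [hV, hamiltonianC, trace_eq (A := A), p_eq (A := A), scalarCurv, h2, h3]
  simp only [inv_gLoc_eq (A := A), mixed_eq (A := A), Real.exp_neg, Fin.sum_univ_two,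
    Matrix.smul_apply, smul_eq_mul, Matrix.one_apply_eq, Matrix.one_apply_ne zero_ne_one,
    Matrix.one_apply_ne one_ne_zero]
  generalize Real.exp (loc e (A.lamHat t) y) = X at h0
  field_simp
  ring

/-- The rescaled momentum constraint. The pure trace part `½ ṽ δ_a^b` of `e^λ k_a^b` does not see
the connection, so that the Christoffel symbols only multiply decaying terms. -/
lemma momentum_sub_eq (he : e ∈ atlas Plane M) {t : ℝ} {y : Plane} (hy : y ∈ e.target)
    (hk : ∀ a b, DifferentiableAt ℝ (kDev A S e t a b) y) (a : Fin 2) :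
    Real.exp (loc e (A.lamHat t) y) *
        (momentumC (S.gLoc e t) (S.kLoc e t) (loc e (S.φ t)) (loc e (S.p t)) a y
          - A.momentumVTD e a t y) =
    -((∑ b, (pd b (kDev A S e t a b) y - kDev A S e t a b y * pd b (loc e (A.lamHat t)) y))
        + (∑ b, ∑ c, (kDev A S e t a c y * christoffel (S.gLoc e t) b b c y
            - kDev A S e t c b y * christoffel (S.gLoc e t) c b a y))
        - (∑ b, (pd a (kDev A S e t b b) y - kDev A S e t b b y * pd a (loc e (A.lamHat t)) y))
        + 2 * (pDev A S e t y * (dphiDev A S e t a y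
              + (pd a (loc e A.φ) y - pd a (loc e A.w) y * t))
            - dphiDev A S e t a y * loc e A.w y)) := by
  have hl : DifferentiableAt ℝ (loc e (A.lamHat t)) y :=
    (contDiffAt_lamHat he hy t).differentiableAt (by simp)
  have hv : DifferentiableAt ℝ (loc e A.v) y := ((contDiffOn_loc he A.analytic_v).contDiffAt
    (e.open_target.mem_nhds hy)).differentiableAt (by simp)
  have hm : ∀ a b d, pd d (mixed (S.gLoc e t) (S.kLoc e t) a b) y =
      Real.exp (-loc e (A.lamHat t) y) *
        (pd d (kDev A S e t a b) y + (1 / 2) * pd d (loc e A.v) y * (1 : Mat) a b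
          - (kDev A S e t a b y + (1 / 2) * loc e A.v y * (1 : Mat) a b)
            * pd d (loc e (A.lamHat t)) y) := by
    intro a b d
    have hc := (hv.const_mul (1 / 2)).mul_const ((1 : Mat) a b)
    rw [funext (mixed_eq (A := A) t a b), pd_exp_neg_mul hl ((hk a b).fun_add hc),
      pd_add (hk a b) hc, pd_mul_const, pd_const_mul]
  have ht : pd a (trace (S.gLoc e t) (S.kLoc e t)) y =
      Real.exp (-loc e (A.lamHat t) y) *
        (pd a (kDev A S e t 0 0) y + pd a (kDev A S e t 1 1) y + pd a (loc e A.v) y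
          - (kDev A S e t 0 0 y + kDev A S e t 1 1 y + loc e A.v y)
            * pd a (loc e (A.lamHat t)) y) := by
    rw [funext (trace_eq (A := A) t), pd_exp_neg_mul hl (((hk 0 0).fun_add (hk 1 1)).fun_add hv),
      pd_add ((hk 0 0).fun_add (hk 1 1)) hv, pd_add (hk 0 0) (hk 1 1)]
  have h0 := (Real.exp_pos (loc e (A.lamHat t) y)).ne'
  rw [momentumC, divergence, AsymptoticData.momentumVTD, ht, p_eq (A := A), dphi_eq (A := A),
    ← pd_lamHat he hy]
  simp only [hm, mixed_eq (A := A), Real.exp_neg, Fin.sum_univ_two]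
  generalize Real.exp (loc e (A.lamHat t) y) = X at h0
  obtain rfl | rfl : a = 0 ∨ a = 1 := by lia
  all_goals
    simp only [Matrix.one_apply_eq, Matrix.one_apply_ne zero_ne_one,
      Matrix.one_apply_ne one_ne_zero]
    field_simp
    ring

lemma subexp_dphi (he : e ∈ atlas Plane M) (hx : x ∈ e.target) (c : Fin 2) :
    Subexp x fun t y => pd c (loc e A.φ) y - pd c (loc e A.w) y * t :=
  ((subexpC_loc (n := 1) he hx A.analytic_φ).partial_deriv c).subexp.sub
    (((subexpC_loc (n := 1) he hx A.analytic_w).partial_deriv c).subexp.mul .time)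

lemma expDecay_hamiltonian (hε : ε.Admissible A) (hS : IsAVTDSolution A ε S)
    (he : e ∈ atlas Plane M) (hx : x ∈ e.target) :
    ExpDecay x fun t y => Real.exp (2 * loc e (A.lamHat t) y) *
        (hamiltonianC (S.gLoc e t) (S.kLoc e t) (loc e (S.φ t)) (loc e (S.p t)) y
          - loc e (A.hamiltonianVTD t) y) := by
  simp only [hamiltonian_sub_eq]
  have hK := fun a b => (expDecay_kDev hε hS he hx a b).1
  have hP := expDecay_pDev hε hS he hx
  have hφ : ∀ a, Subexp x fun t => pd a (loc e (S.φ t)) := fun a =>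
    ((expDecay_dphiDev hε hS he hx a).subexp.add (subexp_dphi (A := A) he hx a)).congr
      (.of_forall fun q => (dphi_eq q.1 a q.2).symm)
  have hv : Subexp x fun _ => loc e A.v := (subexpC_loc (n := 0) he hx A.analytic_v).subexp
  have hw : Subexp x fun _ => loc e A.w := (subexpC_loc (n := 0) he hx A.analytic_w).subexp
  have htr := (hK 0 0).add (hK 1 1)
  refine (Subexp.const _).mul_expDecay (((ExpDecay.sub ?_ ?_).add ?_).add ?_)
  · exact (expDecay_lapse hε he hx).mul <| Subexp.sum fun a _ => Subexp.sum fun b _ =>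
      (subexpC_sInv hε hS he hx a b).subexp.mul
        ((SubexpC.ricci (subexpC_christoffel hε hS he hx) a b).subexp.sub
          ((Subexp.const 2).mul ((hφ a).mul (hφ b))))
  · exact ExpDecay.sum fun a _ => ExpDecay.sum fun b _ => (hK a b).mul (hK b a).subexp
  · exact htr.mul (hv.add htr.subexp)
  · exact hP.mul (((Subexp.const 4).mul hw).sub ((Subexp.const 2).mul hP.subexp))

lemma expDecay_momentum (hε : ε.Admissible A) (hS : IsAVTDSolution A ε S)
    (he : e ∈ atlas Plane M) (hx : x ∈ e.target) (a : Fin 2) :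
    ExpDecay x fun t y => Real.exp (loc e (A.lamHat t) y) *
        (momentumC (S.gLoc e t) (S.kLoc e t) (loc e (S.φ t)) (loc e (S.p t)) a y
          - A.momentumVTD e a t y) := by
  have hK := fun a b => (expDecay_kDev hε hS he hx a b).1
  have hdK := fun a b => (expDecay_kDev hε hS he hx a b).2
  have hP := expDecay_pDev hε hS he hx
  have hQ := expDecay_dphiDev hε hS he hx a
  have hl := fun b => ((subexpC_lamHat (A := A) he hx 1).partial_deriv b).subexp
  have hΓ := fun c a b => (subexpC_christoffel hε hS he hx c a b).subexp
  have hw : Subexp x fun _ => loc e A.w := (subexpC_loc (n := 0) he hx A.analytic_w).subexp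
  have hd := fun a b => differentiableAt_kDev hS he hx a b
  have main := ((((ExpDecay.sum (s := Finset.univ) fun b _ =>
      (hdK a b b).sub ((hK a b).mul (hl b))).add
    (ExpDecay.sum (s := Finset.univ) fun b _ => ExpDecay.sum (s := Finset.univ) fun c _ =>
      ((hK a c).mul (hΓ b b c)).sub ((hK c b).mul (hΓ c b a)))).sub
    (ExpDecay.sum (s := Finset.univ) fun b _ => (hdK b b a).sub ((hK b b).mul (hl a)))).add
    ((Subexp.const 2).mul_expDecay ((hP.mul (hQ.subexp.add (subexp_dphi (A := A) he hx a))).sub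
      (hQ.mul hw)))).neg
  refine main.congr ?_
  filter_upwards [eventually_target hx, hd 0 0, hd 0 1, hd 1 0, hd 1 1] with q hq h1 h2 h3 h4
  refine (momentum_sub_eq he hq (fun a b => ?_) a).symm
  fin_cases a <;> fin_cases b <;> assumption

end Constraints

end AVTD

end

theorem lemma1 {M : Type*} [TopologicalSpace M] [ChartedSpace AVTD.Plane M]
    [IsManifold 𝓘(ℝ, AVTD.Plane) ω M]
    (A : AVTD.AsymptoticData M) (ε : AVTD.Exponents) (hε : ε.Admissible A)
    (S : AVTD.Fields M) (hS : AVTD.IsAVTDSolution A ε S)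
    (e : OpenPartialHomeomorph M AVTD.Plane) (he : e ∈ atlas AVTD.Plane M) :
    TendstoLocallyUniformlyOn
      (fun t y => Real.exp (2 * AVTD.loc e (A.lamHat t) y) *
        (AVTD.hamiltonianC (S.gLoc e t) (S.kLoc e t) (AVTD.loc e (S.φ t)) (AVTD.loc e (S.p t)) y
          - AVTD.loc e (A.hamiltonianVTD t) y))
      0 atTop e.target ∧
    ∀ a : Fin 2, TendstoLocallyUniformlyOn
      (fun t y => Real.exp (AVTD.loc e (A.lamHat t) y) *
        (AVTD.momentumC (S.gLoc e t) (S.kLoc e t) (AVTD.loc e (S.φ t)) (AVTD.loc e (S.p t)) a y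
          - A.momentumVTD e a t y))
      0 atTop e.target := by
  refine ⟨(AVTD.tendstoLocallyUniformlyOn_zero_iff e.open_target).2 fun x hx =>
      (AVTD.expDecay_hamiltonian hε hS he hx).tendsto, fun a =>
    (AVTD.tendstoLocallyUniformlyOn_zero_iff e.open_target).2 fun x hx =>
      (AVTD.expDecay_momentum hε hS he hx a).tendsto⟩
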